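/- Let $n\ge 0$ and let $f\in\mathbb{C}[z_0,\dots,z_n]$ be quasihomogeneous: there are integers $\beta_0,\dots,\beta_n,\beta>0$ with $f(t^{\beta_0}z_0,\dots,t^{\beta_n}z_n)=t^{\beta}f(z_0,\dots,z_n)$ for all $t\in\mathbb{C}^*$. Put $w_i=\beta_i/\beta$, $\deg z_i=w_i$, so that $\deg z^{\alpha}=\sum_i\alpha_iw_i$ for $\alpha\in\mathbb{N}^{n+1}$, and let $K=\sum_{i=0}^n w_iz_i\,\partial/\partial z_i$, a lift along $f$ of the vector field $u\,\partial/\partial u$. Let $R,\delta>0$, let $B_R\subset\mathbb{C}^{n+1}$ be the open ball of radius $R$ about $0$ and $D_\delta^*=\{u\in\mathbb{C}:0<|u|<\delta\}$. For an open set $V\subset D^*_\delta$ put $X_V=f^{-1}(V)\cap B_R$, let $\Omega^k(X_V)$ be the space of holomorphic $k$-forms on $X_V$ (with $\Omega^{-1}=0$), and put $$\mathcal{H}(V)=\Omega^n(X_V)\big/\big(df\wedge\Omega^{n-1}(X_V)+d\,\Omega^{n-1}(X_V)\big),\qquad \mathcal{H}''(V)=\Omega^{n+1}(X_V)\big/\,df\wedge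 d\,\Omega^{n-1}(X_V)$$ (relative de Rham cohomology in degree $n$, and the Brieskorn lattice). The map $\phi\mapsto df\wedge\phi$ induces a map $\mathcal{H}(V)\to\mathcal{H}''(V)$, and the Lie derivative $\mathcal{L}_K=i_Kd+d\,i_K$ induces an endomorphism of $\mathcal{H}(V)$. Let $\nabla$ be the Gauss–Manin connection on $\mathcal{H}(V)$, so that $\nabla_{u\partial/\partial u}[\phi]=[\psi]$ whenever $f\,d\phi=df\wedge\psi$. Then for every $V$ as above and every $\alpha\in\mathbb{N}^{n+1}$ (in particular for each exponent $\alpha(j)$ of a family of monomials representing a basis of the Milnor algebra of $f$) there is exactly one class $\Phi_\alpha\in\mathcal{H}(V)$ with $df\wedge\Phi_\alpha=[z^{\alpha}\,dz_0\wedge\dots\wedge dz_n]$ in $\mathcal{H}''(V)$, and it satisfies $$\mathcal{L}_K\Phi_\alpha=\Big(\deg z^{\alpha}+\sum_{i=0}^n w_i-1\Big)\Phi_\alpha .$$ Moreover $\nabla_{u\partial/\partial u}\Phi_\alpha$ is defined, unique, and equal to $\big(\deg z^{\alpha}+\sum_{i=0}^n w_i-1\big)\Phi_\alpha$. -/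

import Mathlib

open TopologicalSpace

noncomputable section

namespace MilnorBundle

/-- The complex Euclidean space `ℂ^{n+1}` with coordinates `z_0, …, z_n`. -/
abbrev Space (n : ℕ) : Type := EuclideanSpace ℂ (Fin (n + 1))

/-- Values of a `k`-form of type `(k, 0)`: alternating `ℂ`-multilinear maps. -/
abbrev Alt (n k : ℕ) : Type := Space n [⋀^Fin k]→L[ℂ] ℂ

/-! ### Holomorphic forms on open subsets of `ℂ^{n+1}` -/

/-- Holomorphic `k`-forms on the open set `U`, as a subspace of all maps: a form on `U` is
represented by its extension by zero to the whole space, so that two forms are equal iff they agree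
on `U`. -/
def holForms {n : ℕ} (U : Opens (Space n)) (k : ℕ) : Submodule ℂ (Space n → Alt n k) where
  carrier := {ω | AnalyticOnNhd ℂ ω U ∧ ∀ z, z ∉ U → ω z = 0}
  add_mem' := fun ha hb => ⟨ha.1.add hb.1, fun z hz => by simp [ha.2 z hz, hb.2 z hz]⟩
  zero_mem' := ⟨analyticOnNhd_const, fun _ _ => rfl⟩
  smul_mem' := fun c _ ha =>
    ⟨(analyticOnNhd_const (v := c)).smul ha.1, fun z hz => by simp [ha.2 z hz]⟩

/-- `Ω^k(U)`: the complex vector space of holomorphic `k`-forms on the open set `U`. -/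
def HolForm {n : ℕ} (U : Opens (Space n)) (k : ℕ) : Type := holForms U k

variable {n : ℕ} {U : Opens (Space n)} {k : ℕ}

instance : AddCommGroup (HolForm U k) := Submodule.addCommGroup (holForms U k)

instance : Module ℂ (HolForm U k) := Submodule.module (holForms U k)

/-- The value of a form at each point. -/
def HolForm.toFun (ω : HolForm U k) : Space n → Alt n k :=
  Subtype.val (p := fun ω => ω ∈ holForms U k) ω

instance : CoeFun (HolForm U k) (fun _ => Space n → Alt n k) := ⟨HolForm.toFun⟩

theorem HolForm.analytic (ω : HolForm U k) : AnalyticOnNhd ℂ (ω : Space n → Alt n k) U :=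
  (Subtype.property ω).1

theorem HolForm.zero_off (ω : HolForm U k) {z : Space n} (hz : z ∉ U) : ω z = 0 :=
  (Subtype.property ω).2 z hz

theorem HolForm.differentiableAt (ω : HolForm U k) {z : Space n} (hz : z ∈ U) :
    DifferentiableAt ℂ (ω : Space n → Alt n k) z := (ω.analytic z hz).differentiableAt

theorem HolForm.add_apply (ω η : HolForm U k) (z : Space n) : (ω + η) z = ω z + η z := rfl

theorem HolForm.neg_apply (ω : HolForm U k) (z : Space n) : (-ω) z = -ω z := rfl

theorem HolForm.sub_apply (ω η : HolForm U k) (z : Space n) : (ω - η) z = ω z - η z := rfl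

theorem HolForm.zero_apply (z : Space n) : (0 : HolForm U k) z = 0 := rfl

theorem HolForm.smul_apply (c : ℂ) (ω : HolForm U k) (z : Space n) : (c • ω) z = c • ω z := rfl

theorem HolForm.ext_on {ω η : HolForm U k} (h : ∀ z ∈ U, ω z = η z) : ω = η := by
  apply Subtype.ext
  funext z
  by_cases hz : z ∈ U
  · exact h z hz
  · exact (ω.zero_off hz).trans (η.zero_off hz).symm

/-- The form on `U` given by an expression that is holomorphic on `U`. -/
def restrict (U : Opens (Space n)) (ω : Space n → Alt n k) (h : AnalyticOnNhd ℂ ω U) :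
    HolForm U k :=
  ⟨(U : Set (Space n)).indicator ω,
    h.congr U.isOpen (fun _ hz => (Set.indicator_of_mem hz ω).symm),
    fun _ hz => Set.indicator_of_notMem hz ω⟩

theorem restrict_apply {ω : Space n → Alt n k} {h : AnalyticOnNhd ℂ ω U} {z : Space n}
    (hz : z ∈ U) : restrict U ω h z = ω z :=
  Set.indicator_of_mem (s := (U : Set (Space n))) hz ω

section Analytic

variable {E F G H : Type*} [NormedAddCommGroup E] [NormedSpace ℂ E] [NormedAddCommGroup F]
  [NormedSpace ℂ F] [NormedAddCommGroup G] [NormedSpace ℂ G] [NormedAddCommGroup H]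
  [NormedSpace ℂ H]

theorem analyticAt_bilin (B : F →L[ℂ] G →L[ℂ] H) {u : E → F} {v : E → G} {z : E}
    (hu : AnalyticAt ℂ u z) (hv : AnalyticAt ℂ v z) : AnalyticAt ℂ (fun x => B (u x) (v x)) z :=
  (B.analyticAt_bilinear (u z, v z)).comp₂ hu hv

theorem analytic_alternatize {s : Set E} {g : E → E →L[ℂ] E [⋀^Fin k]→L[ℂ] ℂ}
    (hg : AnalyticOnNhd ℂ g s) :
    AnalyticOnNhd ℂ (fun z => ContinuousAlternatingMap.alternatizeUncurryFin (g z)) s := by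
  intro z hz
  exact ((ContinuousAlternatingMap.alternatizeUncurryFinCLM (n := k) ℂ E ℂ).analyticAt
    (g z)).comp (hg z hz)

theorem analytic_curryLeft {s : Set E} {g : E → E [⋀^Fin (k + 1)]→L[ℂ] ℂ}
    (hg : AnalyticOnNhd ℂ g s) (K : E →L[ℂ] E) :
    AnalyticOnNhd ℂ (fun z => (g z).curryLeft (K z)) s := fun z hz =>
  analyticAt_bilin (F := E [⋀^Fin (k + 1)]→L[ℂ] ℂ) (G := E) (H := E [⋀^Fin k]→L[ℂ] ℂ)
    (ContinuousAlternatingMap.curryLeftLI (𝕜 := ℂ) (E := E) (F := ℂ)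
      (n := k)).toContinuousLinearMap (hg z hz) (K.analyticAt z)

theorem analytic_smulRight {s : Set E} {θ : E → E →L[ℂ] ℂ} {g : E → F}
    (hθ : AnalyticOnNhd ℂ θ s) (hg : AnalyticOnNhd ℂ g s) :
    AnalyticOnNhd ℂ (fun z => (θ z).smulRight (g z)) s := fun z hz =>
  analyticAt_bilin (F := E →L[ℂ] ℂ) (G := F) (H := E →L[ℂ] F)
    (ContinuousLinearMap.smulRightL ℂ E F) (hθ z hz) (hg z hz)

end Analytic

theorem HolForm.analytic_extDeriv (ω : HolForm U k) :
    AnalyticOnNhd ℂ (extDeriv (ω : Space n → Alt n k)) U :=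
  analytic_alternatize ω.analytic.fderiv

/-- The exterior derivative `d : Ω^k(U) → Ω^{k+1}(U)`. -/
def d (U : Opens (Space n)) (k : ℕ) : HolForm U k →ₗ[ℂ] HolForm U (k + 1) where
  toFun ω := restrict U (extDeriv (ω : Space n → Alt n k)) ω.analytic_extDeriv
  map_add' ω η := HolForm.ext_on fun z hz => by
    rw [HolForm.add_apply, restrict_apply hz, restrict_apply hz, restrict_apply hz]
    exact extDeriv_add (ω.differentiableAt hz) (η.differentiableAt hz)
  map_smul' c ω := HolForm.ext_on fun z hz => by
    rw [RingHom.id_apply, HolForm.smul_apply, restrict_apply hz, restrict_apply hz]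
    exact extDeriv_smul c (ω : Space n → Alt n k)

theorem d_apply (ω : HolForm U k) {z : Space n} (hz : z ∈ U) :
    d U k ω z = extDeriv (ω : Space n → Alt n k) z :=
  Set.indicator_of_mem (s := (U : Set (Space n))) hz (extDeriv (ω : Space n → Alt n k))

theorem d_d (ω : HolForm U k) : d U (k + 1) (d U k ω) = 0 := HolForm.ext_on fun z hz => by
  rw [d_apply _ hz, HolForm.zero_apply]
  have h : (d U k ω : Space n → Alt n (k + 1)) =ᶠ[nhds z] extDeriv (ω : Space n → Alt n k) := by
    filter_upwards [U.isOpen.mem_nhds hz] with y hy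
    exact d_apply ω hy
  rw [h.extDeriv_eq]
  exact extDeriv_extDeriv_apply (ω.analytic z hz).contDiffAt (r := ⊤) le_top

/-- Multiplication of forms by a function that is holomorphic on the whole space. -/
def mulFun (U : Opens (Space n)) (k : ℕ) (g : Space n → ℂ) (hg : AnalyticOnNhd ℂ g Set.univ) :
    HolForm U k →ₗ[ℂ] HolForm U k where
  toFun ω := restrict U (fun z => g z • ω z) ((hg.mono (Set.subset_univ _)).smul ω.analytic)
  map_add' ω η := HolForm.ext_on fun z hz => by
    rw [HolForm.add_apply, restrict_apply hz, restrict_apply hz, restrict_apply hz]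
    exact smul_add _ _ _
  map_smul' c ω := HolForm.ext_on fun z hz => by
    rw [RingHom.id_apply, HolForm.smul_apply, restrict_apply hz, restrict_apply hz]
    exact smul_comm (g z) c (ω z)

theorem mulFun_apply {g : Space n → ℂ} (hg : AnalyticOnNhd ℂ g Set.univ) (ω : HolForm U k) {z : Space n} (hz : z ∈ U) :
    mulFun U k g hg ω z = g z • ω z :=
  Set.indicator_of_mem (s := (U : Set (Space n))) hz (fun z => g z • ω z)

/-- The wedge product `θ ∧ η` of a covector with an alternating form:
`(θ ∧ η)(v_0, …, v_k) = ∑ᵢ (-1)^i θ(v_i) η(v_0, …, v̂_i, …, v_k)`. -/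
def wedge (θ : Space n →L[ℂ] ℂ) (η : Alt n k) : Alt n (k + 1) :=
  ContinuousAlternatingMap.alternatizeUncurryFin (θ.smulRight η)

theorem wedge_apply (θ : Space n →L[ℂ] ℂ) (η : Alt n k) (v : Fin (k + 1) → Space n) :
    wedge θ η v = ∑ i : Fin (k + 1), (-1) ^ (i : ℕ) • (θ (v i) * η (i.removeNth v)) := by
  simp [wedge, ContinuousAlternatingMap.alternatizeUncurryFin_apply]

theorem wedge_wedge (θ : Space n →L[ℂ] ℂ) (η : Alt n k) : wedge θ (wedge θ η) = 0 := by
  have h := ContinuousAlternatingMap.alternatizeUncurryFin_alternatizeUncurryFinCLM_comp_of_symmetric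
    (f := θ.smulRight (θ.smulRight η)) (by intro x y; ext v; simp; ring)
  rw [← h, wedge, wedge]
  congr 1
  ext x v
  simp

theorem curryLeft_wedge (θ : Space n →L[ℂ] ℂ) (η : Alt n (k + 1)) (x : Space n) :
    (wedge θ η).curryLeft x = θ x • η - wedge θ (η.curryLeft x) := by
  ext v
  simp [wedge_apply, Fin.sum_univ_succ (n := k + 1), Finset.sum_neg_distrib, pow_succ,
    sub_eq_add_neg]
  refine Finset.sum_congr rfl fun i _ => ?_
  congr 3
  funext j
  cases j using Fin.cases <;> simp [Fin.removeNth]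

theorem HolForm.analytic_wedge (ω : HolForm U k) {g : Space n → ℂ}
    (hg : AnalyticOnNhd ℂ g Set.univ) :
    AnalyticOnNhd ℂ (fun z => wedge (fderiv ℂ g z) (ω z)) U :=
  analytic_alternatize (analytic_smulRight (hg.fderiv.mono (Set.subset_univ _)) ω.analytic)

/-- The operation `dg ∧ · : Ω^k(U) → Ω^{k+1}(U)` for a holomorphic function `g`. -/
def dWedge (U : Opens (Space n)) (k : ℕ) (g : Space n → ℂ) (hg : AnalyticOnNhd ℂ g Set.univ) :
    HolForm U k →ₗ[ℂ] HolForm U (k + 1) where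
  toFun ω := restrict U (fun z => wedge (fderiv ℂ g z) (ω z))
    (ω.analytic_wedge hg)
  map_add' ω η := HolForm.ext_on fun z hz => by
    rw [HolForm.add_apply, restrict_apply hz, restrict_apply hz, restrict_apply hz,
      HolForm.add_apply]
    ext v
    simp [wedge_apply, mul_add, Finset.sum_add_distrib]
  map_smul' c ω := HolForm.ext_on fun z hz => by
    rw [RingHom.id_apply, HolForm.smul_apply, restrict_apply hz, restrict_apply hz,
      HolForm.smul_apply]
    ext v
    simp [wedge_apply, mul_left_comm, Finset.mul_sum]

theorem dWedge_apply {g : Space n → ℂ} (hg : AnalyticOnNhd ℂ g Set.univ) (ω : HolForm U k) {z : Space n} (hz : z ∈ U) :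
    dWedge U k g hg ω z = wedge (fderiv ℂ g z) (ω z) :=
  Set.indicator_of_mem (s := (U : Set (Space n))) hz 
    (fun z => wedge (fderiv ℂ g z) (ω z))

/-- `d(gω) = dg ∧ ω + g dω`. -/
theorem d_mulFun {g : Space n → ℂ} (hg : AnalyticOnNhd ℂ g Set.univ) (ω : HolForm U k) :
    d U k (mulFun U k g hg ω) = dWedge U k g hg ω + mulFun U (k + 1) g hg (d U k ω) :=
  HolForm.ext_on fun z hz => by
    have h1 : (mulFun U k g hg ω : Space n → Alt n k) =ᶠ[nhds z] fun z => g z • ω z := by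
      filter_upwards [U.isOpen.mem_nhds hz] with y hy
      exact mulFun_apply hg ω hy
    rw [d_apply _ hz, HolForm.add_apply, h1.extDeriv_eq, dWedge_apply _ _ hz,
      mulFun_apply _ _ hz, d_apply _ hz, extDeriv, extDeriv,
      fderiv_fun_smul (hg z (Set.mem_univ z)).differentiableAt (ω.differentiableAt hz),
      ContinuousAlternatingMap.alternatizeUncurryFin_add,
      ContinuousAlternatingMap.alternatizeUncurryFin_smul]
    exact add_comm _ _

/-- `d(dg ∧ ω) = -dg ∧ dω`. -/
theorem d_dWedge {g : Space n → ℂ} (hg : AnalyticOnNhd ℂ g Set.univ) (ω : HolForm U k) :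
    d U (k + 1) (dWedge U k g hg ω) = -dWedge U (k + 1) g hg (d U k ω) := by
  have h := d_d (mulFun U k g hg ω)
  rw [d_mulFun, map_add, d_mulFun, d_d, map_zero, add_zero] at h
  exact eq_neg_of_add_eq_zero_left h

/-- The interior product `i_K : Ω^{k+1}(U) → Ω^k(U)` with a linear vector field `K`:
`(i_K ω)(v_1, …, v_k) = ω(K, v_1, …, v_k)`. -/
def contract (U : Opens (Space n)) (k : ℕ) (K : Space n →L[ℂ] Space n) :
    HolForm U (k + 1) →ₗ[ℂ] HolForm U k where
  toFun ω := restrict U (fun z => (ω z).curryLeft (K z)) (analytic_curryLeft ω.analytic K)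
  map_add' ω η := HolForm.ext_on fun z hz => by
    rw [HolForm.add_apply, restrict_apply hz, restrict_apply hz, restrict_apply hz]
    rfl
  map_smul' c ω := HolForm.ext_on fun z hz => by
    rw [RingHom.id_apply, HolForm.smul_apply, restrict_apply hz, restrict_apply hz]
    rfl

theorem contract_apply (K : Space n →L[ℂ] Space n) (ω : HolForm U (k + 1)) {z : Space n} (hz : z ∈ U) :
    contract U k K ω z = (ω z).curryLeft (K z) :=
  Set.indicator_of_mem (s := (U : Set (Space n))) hz 
    (fun z => (ω z).curryLeft (K z))

/-- `i_K(dg ∧ ω) = dg(K) ω - dg ∧ i_K ω`, here for `dg(K) = g`. -/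
theorem contract_dWedge {g : Space n → ℂ} (hg : AnalyticOnNhd ℂ g Set.univ)
    {K : Space n →L[ℂ] Space n} (hK : ∀ z, fderiv ℂ g z (K z) = g z) (ω : HolForm U (k + 1)) :
    contract U (k + 1) K (dWedge U (k + 1) g hg ω) =
      mulFun U (k + 1) g hg ω - dWedge U k g hg (contract U k K ω) :=
  HolForm.ext_on fun z hz => by
    rw [HolForm.sub_apply, contract_apply _ _ hz, dWedge_apply _ _ hz, mulFun_apply _ _ hz,
      dWedge_apply _ _ hz, contract_apply _ _ hz, curryLeft_wedge, hK]

/-- The Lie derivative of holomorphic forms along a linear vector field `K`,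
`L_K = i_K ∘ d + d ∘ i_K` (with `i_K = 0` on functions). -/
def lie (U : Opens (Space n)) (K : Space n →L[ℂ] Space n) :
    (k : ℕ) → HolForm U k →ₗ[ℂ] HolForm U k
  | 0 => contract U 0 K ∘ₗ d U 0
  | k + 1 => contract U (k + 1) K ∘ₗ d U (k + 1) + d U k ∘ₗ contract U k K

/-! ### Quasihomogeneous polynomials -/

/-- `f ∈ ℂ[z_0, …, z_n]` is quasihomogeneous: `β_0, …, β_n, β > 0` are integers and
`f(t^{β_0} z_0, …, t^{β_n} z_n) = t^β f(z_0, …, z_n)` for all `t ∈ ℂ^*`. -/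
structure IsQuasihomogeneous (f : MvPolynomial (Fin (n + 1)) ℂ) (β : Fin (n + 1) → ℕ) (b : ℕ) :
    Prop where
  weight_pos : ∀ i, 0 < β i
  degree_pos : 0 < b
  eval_smul : ∀ (t : ℂ), t ≠ 0 → ∀ z : Fin (n + 1) → ℂ,
    MvPolynomial.eval (fun i => t ^ β i * z i) f = t ^ b * MvPolynomial.eval z f

/-- The polynomial function on `ℂ^{n+1}` defined by `f`. -/
def polyFun (f : MvPolynomial (Fin (n + 1)) ℂ) (z : Space n) : ℂ :=
  MvPolynomial.eval (fun i => z i) f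

theorem analytic_polyFun (f : MvPolynomial (Fin (n + 1)) ℂ) :
    AnalyticOnNhd ℂ (polyFun f) Set.univ := by
  have h := AnalyticOnNhd.aeval_mvPolynomial (𝕜 := ℂ) (A := ℂ) (B := ℂ) (E := Space n)
    (s := Set.univ) (f := fun (z : Space n) i => z i)
    (fun i => (EuclideanSpace.proj (𝕜 := ℂ) i : Space n →L[ℂ] ℂ).analyticOnNhd Set.univ) f
  simp only [MvPolynomial.aeval_eq_eval] at h
  exact h

/-- The weights `w_i = β_i / β`. -/
def weight (β : Fin (n + 1) → ℕ) (b : ℕ) (i : Fin (n + 1)) : ℂ := (β i : ℂ) / (b : ℂ)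

/-- The degree of the monomial `z^α`, where `deg z_i = w_i`. -/
def monomialDegree (β : Fin (n + 1) → ℕ) (b : ℕ) (α : Fin (n + 1) → ℕ) : ℂ :=
  ∑ i, (α i : ℂ) * weight β b i

/-- The vector field `K = ∑ᵢ w_i z_i ∂/∂z_i`. -/
def eulerField (β : Fin (n + 1) → ℕ) (b : ℕ) : Space n →L[ℂ] Space n :=
  LinearMap.toContinuousLinearMap
    { toFun := fun z => WithLp.toLp 2 fun i => weight β b i * z i
      map_add' := fun x y => by ext i; simp [mul_add]
      map_smul' := fun c x => by ext i; simp [mul_left_comm] }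

/-- `df(K) = f`, so `K` lifts the vector field `u ∂/∂u` along `f`. -/
theorem fderiv_eulerField {f : MvPolynomial (Fin (n + 1)) ℂ} {β : Fin (n + 1) → ℕ} {b : ℕ}
    (hf : IsQuasihomogeneous f β b) (z : Space n) :
    fderiv ℂ (polyFun f) z (eulerField β b z) = polyFun f z := by
  let c : ℂ → Space n := fun t => WithLp.toLp 2 fun i => t ^ β i * z i
  have hb : (b : ℂ) ≠ 0 := by exact_mod_cast hf.degree_pos.ne'
  have hc1 : c 1 = z := by ext i; simp [c]
  have hc : HasDerivAt c ((b : ℂ) • eulerField β b z) 1 := by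
    refine hasDerivAt_iff_hasFDerivAt.2
      (HasStrictFDerivAt.hasFDerivAt (hasStrictFDerivAt_euclidean.2 fun i => ?_))
    have h := ((hasStrictDerivAt_pow (β i) (1 : ℂ)).mul_const (z i)).hasStrictFDerivAt
    refine h.congr_fderiv ?_
    ext
    simp [eulerField, weight]
    field_simp
  have hd : DifferentiableAt ℂ (polyFun f) (c 1) :=
    (analytic_polyFun f (c 1) (Set.mem_univ _)).differentiableAt
  have h1 := HasFDerivAt.comp_hasDerivAt (x := (1 : ℂ)) (f := c) hd.hasFDerivAt hc
  have h2 : HasDerivAt (fun t : ℂ => t ^ b * polyFun f z) ((b : ℂ) * polyFun f z) 1 := by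
    simpa using (hasDerivAt_pow b (1 : ℂ)).mul_const (polyFun f z)
  have h3 := h1.unique (h2.congr_of_eventuallyEq (by
    filter_upwards [isOpen_ne.mem_nhds (one_ne_zero : (1 : ℂ) ≠ 0)] with t ht
    exact hf.eval_smul t ht _))
  rw [map_smul, smul_eq_mul, hc1] at h3
  exact mul_left_cancel₀ hb h3

/-! ### The Milnor bundle, relative cohomology and the Brieskorn lattice -/

/-- `X_V = f⁻¹(V) ∩ B_R`, the part of the Milnor bundle over the open set `V ⊆ ℂ`, where `B_R` is
the open ball of radius `R` in `ℂ^{n+1}`. Thus `Ω^k(X_V)` are the sections of `f_* Ω^k_X`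
over `V`. -/
def bundleOver (f : MvPolynomial (Fin (n + 1)) ℂ) (R : ℝ) (V : Opens ℂ) : Opens (Space n) where
  carrier := polyFun f ⁻¹' V ∩ Metric.ball 0 R
  is_open' := (V.isOpen.preimage
    (continuousOn_univ.mp (analytic_polyFun f).continuousOn)).inter Metric.isOpen_ball

/-- `df ∧ · : Ω^k(U) → Ω^{k+1}(U)`. -/
def dfWedge (f : MvPolynomial (Fin (n + 1)) ℂ) (U : Opens (Space n)) (k : ℕ) :
    HolForm U k →ₗ[ℂ] HolForm U (k + 1) := dWedge U k (polyFun f) (analytic_polyFun f)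

/-- `d Ω^{k-1}(U) ⊆ Ω^k(U)`, with `Ω^{-1} = 0`. -/
def exactForms (U : Opens (Space n)) : (k : ℕ) → Submodule ℂ (HolForm U k)
  | 0 => ⊥
  | k + 1 => LinearMap.range (d U k)

/-- `df ∧ Ω^{k-1}(U) ⊆ Ω^k(U)`, with `Ω^{-1} = 0`. The relative forms are
`Ω^k_{X/D}(U) = Ω^k(U) / df ∧ Ω^{k-1}(U)`. -/
def dfForms (f : MvPolynomial (Fin (n + 1)) ℂ) (U : Opens (Space n)) :
    (k : ℕ) → Submodule ℂ (HolForm U k)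
  | 0 => ⊥
  | k + 1 => LinearMap.range (dfWedge f U k)

/-- `Ω^n_{X/D} / d Ω^{n-1}_{X/D} = Ω^n / (df ∧ Ω^{n-1} + d Ω^{n-1})` on `U`. This is the
`n`-th cohomology of the relative de Rham complex where `f` is a submersion, because `n` is then
the top degree of relative forms. -/
abbrev RelCohomology (f : MvPolynomial (Fin (n + 1)) ℂ) (U : Opens (Space n)) : Type :=
  HolForm U n ⧸ (dfForms f U n ⊔ exactForms U n)

/-- The Brieskorn lattice `Ω^{n+1} / df ∧ d Ω^{n-1}` on `U`. -/
abbrev BrieskornLattice (f : MvPolynomial (Fin (n + 1)) ℂ) (U : Opens (Space n)) : Type :=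
  HolForm U (n + 1) ⧸ (exactForms U n).map (dfWedge f U n)

theorem dfWedge_dfWedge (f : MvPolynomial (Fin (n + 1)) ℂ) (ω : HolForm U k) :
    dfWedge f U (k + 1) (dfWedge f U k ω) = 0 :=
  HolForm.ext_on fun z hz => by
    rw [dfWedge, dfWedge, dWedge_apply _ _ hz, dWedge_apply _ _ hz, wedge_wedge,
      HolForm.zero_apply]

theorem dfWedge_descends (f : MvPolynomial (Fin (n + 1)) ℂ) (U : Opens (Space n)) (k : ℕ) :
    dfForms f U k ⊔ exactForms U k ≤
      ((exactForms U k).map (dfWedge f U k)).comap (dfWedge f U k) := by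
  refine sup_le ?_ (Submodule.le_comap_map _ _)
  cases k with
  | zero => exact bot_le
  | succ k =>
    rintro _ ⟨ω, rfl⟩
    rw [Submodule.mem_comap, dfWedge_dfWedge]
    exact Submodule.zero_mem _

/-- The map `df ∧ ·` from relative cohomology to the Brieskorn lattice. -/
def dfWedgeClass (f : MvPolynomial (Fin (n + 1)) ℂ) (U : Opens (Space n)) :
    RelCohomology f U →ₗ[ℂ] BrieskornLattice f U :=
  Submodule.mapQ _ _ (dfWedge f U n) (dfWedge_descends f U n)

/-- The `(n+1)`-form `dz_0 ∧ … ∧ dz_n`, i.e. the determinant. -/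
def coordVolume (n : ℕ) : Alt n (n + 1) :=
  { (Matrix.detRowAlternating (n := Fin (n + 1)) (R := ℂ)).compLinearMap
      (EuclideanSpace.equiv (Fin (n + 1)) ℂ).toLinearEquiv.toLinearMap with
    cont := by
      change Continuous fun v : Fin (n + 1) → Space n => Matrix.det (Matrix.of fun i j => v i j)
      fun_prop }

theorem coordVolume_apply (v : Fin (n + 1) → Space n) :
    coordVolume n v = Matrix.det (Matrix.of fun i j => v i j) := rfl

theorem analytic_monomial (α : Fin (n + 1) → ℕ) (s : Set (Space n)) :
    AnalyticOnNhd ℂ (fun z : Space n => ∏ i, z i ^ α i) s := by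
  apply Finset.analyticOnNhd_fun_prod
  intro i _
  exact ((EuclideanSpace.proj (𝕜 := ℂ) i : Space n →L[ℂ] ℂ).analyticOnNhd s).pow _

/-- The form `z^α dz_0 ∧ … ∧ dz_n` on `U`. -/
def monomialForm (U : Opens (Space n)) (α : Fin (n + 1) → ℕ) : HolForm U (n + 1) :=
  restrict U (fun z => (∏ i, z i ^ α i) • coordVolume n)
    ((analytic_monomial α U).smul analyticOnNhd_const)

/-- The class of `z^α dz_0 ∧ … ∧ dz_n` in the Brieskorn lattice. -/
def monomialClass (f : MvPolynomial (Fin (n + 1)) ℂ) (U : Opens (Space n))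
    (α : Fin (n + 1) → ℕ) : BrieskornLattice f U :=
  Submodule.Quotient.mk (monomialForm U α)

/-! ### Lie derivative and Gauss–Manin connection on relative cohomology -/

/-- `L_K` preserves `df ∧ Ω^{k-1} + d Ω^{k-1}`. -/
theorem lie_descends {f : MvPolynomial (Fin (n + 1)) ℂ} {β : Fin (n + 1) → ℕ} {b : ℕ}
    (hf : IsQuasihomogeneous f β b) (U : Opens (Space n)) (k : ℕ) :
    dfForms f U k ⊔ exactForms U k ≤
      (dfForms f U k ⊔ exactForms U k).comap (lie U (eulerField β b) k) := by
  cases k with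
  | zero => exact sup_le bot_le bot_le
  | succ k =>
    refine sup_le ?_ ?_
    · rintro _ ⟨η, rfl⟩
      have h : contract U (k + 1) (eulerField β b) (d U (k + 1) (dfWedge f U k η)) =
          dfWedge f U k (η + contract U k (eulerField β b) (d U k η)) -
            d U k (mulFun U k (polyFun f) (analytic_polyFun f) η) := by
        rw [dfWedge, d_dWedge, map_neg, contract_dWedge _ (fderiv_eulerField hf), d_mulFun,
          map_add]
        abel
      rw [Submodule.mem_comap, lie, LinearMap.add_apply, LinearMap.comp_apply,
        LinearMap.comp_apply, h]
      exact Submodule.add_mem _ (Submodule.sub_mem _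
        (Submodule.mem_sup_left ⟨_, rfl⟩) (Submodule.mem_sup_right ⟨_, rfl⟩))
        (Submodule.mem_sup_right ⟨_, rfl⟩)
    · rintro _ ⟨η, rfl⟩
      rw [Submodule.mem_comap, lie, LinearMap.add_apply, LinearMap.comp_apply,
        LinearMap.comp_apply, d_d, map_zero, zero_add]
      exact Submodule.mem_sup_right ⟨_, rfl⟩

/-- The Lie derivative `L_K` acting on relative cohomology classes. -/
def lieClass {f : MvPolynomial (Fin (n + 1)) ℂ} {β : Fin (n + 1) → ℕ} {b : ℕ}
    (hf : IsQuasihomogeneous f β b) (U : Opens (Space n)) :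
    RelCohomology f U →ₗ[ℂ] RelCohomology f U :=
  Submodule.mapQ _ _ (lie U (eulerField β b) n) (lie_descends hf U n)

/-- `Ψ = ∇_{u ∂/∂u} Φ` for the Gauss–Manin connection `∇` on relative cohomology: by definition,
`∇_{∂/∂u} [φ] = [η]` if `dφ = df ∧ η`, so that `∇_{u ∂/∂u} [φ] = [ψ]` if `f dφ = df ∧ ψ`. -/
def IsGaussManinDeriv (f : MvPolynomial (Fin (n + 1)) ℂ) (U : Opens (Space n))
    (Φ Ψ : RelCohomology f U) : Prop :=
  ∃ φ ψ : HolForm U n, Submodule.Quotient.mk φ = Φ ∧ Submodule.Quotient.mk ψ = Ψ ∧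
    mulFun U (n + 1) (polyFun f) (analytic_polyFun f) (d U n φ) = dfWedge f U n ψ

end MilnorBundle

end

noncomputable section

namespace MilnorBundle

variable {n : ℕ} {U : Opens (Space n)} {k : ℕ}

/-! ### Algebra of multiplication, contraction and exterior multiplication by `dg`. -/

section Operators

variable {g : Space n → ℂ} (hg : AnalyticOnNhd ℂ g Set.univ)

/-! Since `0 ∉ V`, `f` is invertible on `X_V`. From `df(K) = f` one gets `i_K(df ∧ θ) = f θ - df ∧
i_K θ`, so `f⁻¹ i_K` is a contracting homotopy for `df ∧ ·`. Hence the kernel of `df ∧ ·` is its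
image (`mem_dfForms_of_dfWedge_eq_zero`), which gives uniqueness of `Φ_α` and of the Gauss–Manin
derivative.

For existence put `ω = z^α dz_0 ∧ … ∧ dz_n` and `φ = f⁻¹ i_K ω`. As `df ∧ ω = 0` for degree reasons,
the homotopy gives `df ∧ φ = ω`. The divergence of `z^α K` is `c z^α` with `c = deg z^α + ∑ w_i`
(`d_contract_monomialForm`), so `c ω = d(fφ) = ω + f dφ`, that is, `f dφ = (c - 1) df ∧ φ`. This is
the Gauss–Manin statement; contracting with `K` and using `i_K φ = 0` gives the Lie derivative,
already at the level of forms. -/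

theorem mulFun_injective (h0 : ∀ z ∈ U, g z ≠ 0) : Function.Injective (mulFun U k g hg) := by
  intro ω η h
  refine HolForm.ext_on fun z hz => ?_
  have h1 := congrArg (fun θ : HolForm U k => θ z) h
  simp only [mulFun_apply hg _ hz] at h1
  exact smul_right_injective _ (h0 z hz) h1

theorem mulFun_surjective (h0 : ∀ z ∈ U, g z ≠ 0) : Function.Surjective (mulFun U k g hg) := by
  intro ω
  refine ⟨restrict U (fun z => (g z)⁻¹ • ω z)
    (((hg.mono (Set.subset_univ _)).inv h0).smul ω.analytic), HolForm.ext_on fun z hz => ?_⟩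
  rw [mulFun_apply hg _ hz, restrict_apply hz, smul_inv_smul₀ (h0 z hz)]

theorem contract_mulFun (K : Space n →L[ℂ] Space n) (ω : HolForm U (k + 1)) :
    contract U k K (mulFun U (k + 1) g hg ω) = mulFun U k g hg (contract U k K ω) :=
  HolForm.ext_on fun z hz => by
    rw [contract_apply _ _ hz, mulFun_apply _ _ hz, mulFun_apply _ _ hz, contract_apply _ _ hz]
    rfl

theorem dWedge_mulFun {h : Space n → ℂ} (hh : AnalyticOnNhd ℂ h Set.univ) (ω : HolForm U k) :
    dWedge U k h hh (mulFun U k g hg ω) = mulFun U (k + 1) g hg (dWedge U k h hh ω) :=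
  HolForm.ext_on fun z hz => by
    rw [dWedge_apply _ _ hz, mulFun_apply _ _ hz, mulFun_apply _ _ hz, dWedge_apply _ _ hz]
    ext v
    simp [wedge_apply, mul_left_comm, Finset.mul_sum]

theorem contract_contract (K : Space n →L[ℂ] Space n) (ω : HolForm U (k + 2)) :
    contract U k K (contract U (k + 1) K ω) = 0 :=
  HolForm.ext_on fun z hz => by
    rw [contract_apply _ _ hz, contract_apply _ _ hz, HolForm.zero_apply]
    ext v
    exact (ω z).map_eq_zero_of_eq _ (i := 0) (j := 1) (by simp) (by simp)

/-- The bottom-degree case of `contract_dWedge`: the correction term is absent because `i_K`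
vanishes on functions. -/
theorem contract_dWedge_zero {K : Space n →L[ℂ] Space n} (hK : ∀ z, fderiv ℂ g z (K z) = g z)
    (ω : HolForm U 0) : contract U 0 K (dWedge U 0 g hg ω) = mulFun U 0 g hg ω :=
  HolForm.ext_on fun z hz => by
    rw [contract_apply _ _ hz, dWedge_apply _ _ hz, mulFun_apply _ _ hz]
    ext v
    simp [wedge_apply, hK]

/-- There are no nonzero forms of degree greater than `n + 1`. -/
theorem HolForm.eq_zero_of_lt (hk : n + 1 < k) (ω : HolForm U k) : ω = 0 :=
  HolForm.ext_on fun z _ => by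
    ext v
    refine (ω z).toAlternatingMap.map_linearDependent v fun h => ?_
    have := h.fintype_card_le_finrank
    simp at this
    omega

end Operators

/-! ### The divergence of the vector field `z^α K`. -/

section Divergence

/-- The linear algebra behind `d(i_X vol) = div(X) vol`, with `A` the derivative of `X` at a point
and the divergence its trace. It suffices to evaluate on permuted standard bases. -/
theorem alternatizeUncurryFin_curryLeft_comp (A : Space n →L[ℂ] Space n) :
    ContinuousAlternatingMap.alternatizeUncurryFin
      ((ContinuousAlternatingMap.curryLeftLI (𝕜 := ℂ) (E := Space n) (F := ℂ)
        (n := n) (coordVolume n)).comp A) =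
      (∑ i, A (EuclideanSpace.single i 1) i) • coordVolume n := by
  apply ContinuousAlternatingMap.toAlternatingMap_injective
  refine Module.Basis.ext_alternating (EuclideanSpace.basisFun (Fin (n + 1)) ℂ).toBasis ?_
  intro σ hσ
  have hσ' : Function.Bijective σ := Finite.injective_iff_bijective.1 hσ
  set v : Fin (n + 1) → Space n := fun i => (EuclideanSpace.basisFun (Fin (n + 1)) ℂ).toBasis (σ i)
    with hv
  have hv' (i) : v i = EuclideanSpace.single (σ i) 1 := by simp [hv]
  -- Moving `A (v i)` from the front to slot `i` absorbs the sign. Expanded in the basis `v`, only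
  -- its `v i` component survives, since any other repeats an argument.
  have key (i : Fin (n + 1)) : (-1 : ℤ) ^ (i : ℕ) •
      coordVolume n (Matrix.vecCons (A (v i)) (i.removeNth v)) =
        A (v i) (σ i) * coordVolume n v := by
    have h2 := (coordVolume n).toAlternatingMap.map_insertNth i (A (v i)) (i.removeNth v)
    have h3 : A (v i) = ∑ j, A (v i) (σ j) • v j := by
      simp only [hv']
      rw [hσ'.sum_comp fun j => A (EuclideanSpace.single (σ i) 1) j • EuclideanSpace.single j (1 : ℂ)]
      ext j
      simp [Pi.single_apply]
    have h4 : (coordVolume n).toAlternatingMap (Function.update v i (A (v i))) =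
        A (v i) (σ i) * coordVolume n v := by
      nth_rw 1 [h3]
      rw [AlternatingMap.map_update_sum, Finset.sum_eq_single i]
      · rw [AlternatingMap.map_update_smul, Function.update_eq_self]
        rfl
      · intro j _ hj
        rw [AlternatingMap.map_update_smul, AlternatingMap.map_update_self _ _ hj.symm, smul_zero]
      · simp
    rw [← h4, ← Fin.insertNth_removeNth]
    exact h2.symm
  change ContinuousAlternatingMap.alternatizeUncurryFin _ v =
    (∑ i, A (EuclideanSpace.single i 1) i) * coordVolume n v
  rw [ContinuousAlternatingMap.alternatizeUncurryFin_apply,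
    ← hσ'.sum_comp fun i => A (EuclideanSpace.single i 1) i, Finset.sum_mul]
  refine Finset.sum_congr rfl fun i _ => ?_
  rw [← hv' i]
  exact key i

theorem fderiv_monomial_eulerField (β : Fin (n + 1) → ℕ) (b : ℕ) (α : Fin (n + 1) → ℕ)
    (z : Space n) :
    fderiv ℂ (fun z : Space n => ∏ i, z i ^ α i) z (eulerField β b z) =
      monomialDegree β b α * ∏ i, z i ^ α i := by
  have h : HasFDerivAt (fun z : Space n => ∏ i, z i ^ α i) _ z :=
    HasFDerivAt.finsetProd (u := Finset.univ) (g := fun i (z : Space n) => z i ^ α i)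
      fun i _ => ((EuclideanSpace.proj (𝕜 := ℂ) i : Space n →L[ℂ] ℂ).hasFDerivAt (x := z)).pow (α i)
  rw [h.fderiv, monomialDegree, Finset.sum_mul]
  simp only [_root_.sum_apply]
  refine Finset.sum_congr rfl fun i _ => ?_
  rw [← Finset.prod_erase_mul _ _ (Finset.mem_univ i)]
  simp [eulerField]
  -- The power rule involves the truncated `α i - 1`, so exponent zero is treated apart.
  cases α i <;> simp [pow_succ]
  ring

/-- The product rule `div(z^α K) = K(z^α) + z^α div K`: Euler's identity gives the degree, and `div
K` is the sum of the weights. -/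
theorem d_contract_monomialForm (β : Fin (n + 1) → ℕ) (b : ℕ) (α : Fin (n + 1) → ℕ) :
    d U n (contract U n (eulerField β b) (monomialForm U α)) =
      (monomialDegree β b α + ∑ i, weight β b i) • monomialForm U α :=
  HolForm.ext_on fun z hz => by
    let m : Space n → ℂ := fun z => ∏ i, z i ^ α i
    let K : Space n →L[ℂ] Space n := eulerField β b
    let T := (ContinuousAlternatingMap.curryLeftLI (𝕜 := ℂ) (E := Space n) (F := ℂ)
        (n := n) (coordVolume n))
    have h1 : (contract U n K (monomialForm U α) : Space n → Alt n n) =ᶠ[nhds z]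
        fun z => T (m z • K z) := by
      filter_upwards [U.isOpen.mem_nhds hz] with y hy
      rw [contract_apply _ _ hy, monomialForm, restrict_apply hy, map_smul]
      rfl
    have hm : DifferentiableAt ℂ m z :=
      (analytic_monomial α Set.univ z (Set.mem_univ z)).differentiableAt
    have h2 : HasFDerivAt (fun z => T (m z • K z))
        (T.comp (m z • K + (fderiv ℂ m z).smulRight (K z))) z :=
      T.hasFDerivAt.comp z (hm.hasFDerivAt.smul K.hasFDerivAt)
    rw [d_apply _ hz, h1.extDeriv_eq, extDeriv, h2.fderiv,
      alternatizeUncurryFin_curryLeft_comp, HolForm.smul_apply, monomialForm, restrict_apply hz,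
      smul_smul]
    congr 1
    have h3 : K z = ∑ i, K z i • EuclideanSpace.single i (1 : ℂ) := by
      ext j; simp [Pi.single_apply]
    have h4 := fderiv_monomial_eulerField β b α z
    change fderiv ℂ m z (K z) = monomialDegree β b α * m z at h4
    rw [add_mul, ← h4]
    -- Only the argument of `fderiv ℂ m z` is expanded, to match the trace term by term.
    nth_rw 2 [h3]
    simp only [map_sum, map_smul, smul_eq_mul]
    rw [Finset.sum_mul, ← Finset.sum_add_distrib]
    refine Finset.sum_congr rfl fun i _ => ?_
    simp [K, m, eulerField]
    ring

end Divergence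

/-! ### Exactness of `df ∧ ·` and its consequences for cohomology classes. -/

section Cohomology

variable {f : MvPolynomial (Fin (n + 1)) ℂ} {β : Fin (n + 1) → ℕ} {b : ℕ}

theorem polyFun_ne_zero_of_mem_bundleOver {R : ℝ} {V : Opens ℂ} (hV : (0 : ℂ) ∉ V) :
    ∀ z ∈ bundleOver f R V, polyFun f z ≠ 0 :=
  fun _ hz h => hV (h ▸ hz.1)

/-- `df ∧ ·` is exact where `f` has no zeros. -/
theorem mem_dfForms_of_dfWedge_eq_zero (hf : IsQuasihomogeneous f β b)
    (h0 : ∀ z ∈ U, polyFun f z ≠ 0) {θ : HolForm U k} (hθ : dfWedge f U k θ = 0) :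
    θ ∈ dfForms f U k := by
  cases k with
  | zero =>
    have h := contract_dWedge_zero (analytic_polyFun f) (fderiv_eulerField hf) θ
    rw [← dfWedge, hθ, map_zero] at h
    exact mulFun_injective (analytic_polyFun f) h0 (h.symm.trans (map_zero _).symm)
  | succ k =>
    have h := contract_dWedge (analytic_polyFun f) (fderiv_eulerField hf) θ
    rw [← dfWedge, hθ, map_zero] at h
    -- Now `h` reads `0 = f θ - df ∧ i_K θ`, so `η = f⁻¹ i_K θ` is the primitive.
    obtain ⟨η, hη⟩ := mulFun_surjective (analytic_polyFun f) h0 (contract U k (eulerField β b) θ)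
    refine ⟨η, mulFun_injective (analytic_polyFun f) h0 ?_⟩
    rw [dfWedge, ← dWedge_mulFun, hη]
    exact (sub_eq_zero.1 h.symm).symm

/-- If `df ∧ φ = df ∧ η` with `η` exact, then `df ∧ ·` kills `φ - η`, which therefore lies in its
image. -/
theorem dfWedgeClass_injective (hf : IsQuasihomogeneous f β b)
    (h0 : ∀ z ∈ U, polyFun f z ≠ 0) : Function.Injective (dfWedgeClass f U) := by
  rw [injective_iff_map_eq_zero]
  intro Φ h
  obtain ⟨φ, rfl⟩ := Submodule.Quotient.mk_surjective _ Φ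
  rw [dfWedgeClass, Submodule.mapQ_apply, Submodule.Quotient.mk_eq_zero] at h
  obtain ⟨η, hη, h⟩ := h
  rw [Submodule.Quotient.mk_eq_zero, ← sub_add_cancel φ η]
  refine Submodule.add_mem_sup (mem_dfForms_of_dfWedge_eq_zero hf h0 ?_) hη
  rw [map_sub, h, sub_self]

/-- `u ∂/∂u` maps the zero class to the zero class. -/
theorem exists_mulFun_d_eq_dfWedge {ξ : HolForm U k} (hξ : ξ ∈ dfForms f U k ⊔ exactForms U k) :
    ∃ θ ∈ dfForms f U k ⊔ exactForms U k,
      mulFun U (k + 1) (polyFun f) (analytic_polyFun f) (d U k ξ) = dfWedge f U k θ := by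
  cases k with
  | zero =>
    obtain rfl : ξ = 0 := by simpa [dfForms, exactForms] using hξ
    exact ⟨0, zero_mem _, by simp⟩
  | succ k =>
    obtain ⟨_, ⟨a, rfl⟩, _, ⟨η, rfl⟩, rfl⟩ := Submodule.mem_sup.1 hξ
    -- By the Leibniz rule this witness is `-f da`, and `f d(df ∧ a) = df ∧ (-f da)`.
    refine ⟨dfWedge f U k a - d U k (mulFun U k (polyFun f) (analytic_polyFun f) a),
      sub_mem (Submodule.mem_sup_left ⟨_, rfl⟩) (Submodule.mem_sup_right ⟨_, rfl⟩), ?_⟩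
    rw [map_add, d_d, add_zero, d_mulFun, dfWedge, dfWedge, d_dWedge, sub_add_cancel_left,
      map_neg, map_neg, dWedge_mulFun]

/-- Changing the representative of `Φ` changes `ψ` by some `θ` of zero class, up to the kernel of
`df ∧ ·`, which is zero in cohomology by exactness. -/
theorem IsGaussManinDeriv.unique (hf : IsQuasihomogeneous f β b)
    (h0 : ∀ z ∈ U, polyFun f z ≠ 0) {Φ Ψ₁ Ψ₂ : RelCohomology f U}
    (h₁ : IsGaussManinDeriv f U Φ Ψ₁) (h₂ : IsGaussManinDeriv f U Φ Ψ₂) : Ψ₁ = Ψ₂ := by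
  obtain ⟨φ₁, ψ₁, hφ₁, rfl, h₁⟩ := h₁
  obtain ⟨φ₂, ψ₂, hφ₂, rfl, h₂⟩ := h₂
  obtain ⟨θ, hθ, h⟩ := exists_mulFun_d_eq_dfWedge
    ((Submodule.Quotient.eq _).1 (hφ₁.trans hφ₂.symm))
  rw [Submodule.Quotient.eq, ← sub_add_cancel (ψ₁ - ψ₂) θ]
  refine add_mem (Submodule.mem_sup_left (mem_dfForms_of_dfWedge_eq_zero hf h0 ?_)) hθ
  rw [map_sub, map_sub, ← h, map_sub, map_sub, h₁, h₂, sub_self]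

/-- The form `φ = f⁻¹ i_K(z^α dz_0 ∧ … ∧ dz_n)` and its basic identities. -/
theorem exists_monomial_primitive (hf : IsQuasihomogeneous f β b)
    (h0 : ∀ z ∈ U, polyFun f z ≠ 0) (α : Fin (n + 1) → ℕ) :
    ∃ φ : HolForm U n, dfWedge f U n φ = monomialForm U α ∧
      mulFun U (n + 1) (polyFun f) (analytic_polyFun f) (d U n φ) =
        (monomialDegree β b α + ∑ i, weight β b i - 1) • monomialForm U α ∧
      lie U (eulerField β b) n φ = (monomialDegree β b α + ∑ i, weight β b i - 1) • φ := by
  have inj {k} := mulFun_injective (k := k) (analytic_polyFun f) h0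
  obtain ⟨φ, hφ⟩ := mulFun_surjective (analytic_polyFun f) h0
    (contract U n (eulerField β b) (monomialForm U α))
  have h1 : dfWedge f U n φ = monomialForm U α := by
    apply inj
    have h := contract_dWedge (analytic_polyFun f) (fderiv_eulerField hf) (monomialForm U α)
    -- The form `df ∧ ω` has degree `n + 2`, so only `f ω = df ∧ i_K ω` remains.
    rw [HolForm.eq_zero_of_lt (by omega) (dWedge U (n + 1) _ _ (monomialForm U α)), map_zero] at h
    rw [dfWedge, ← dWedge_mulFun, hφ]
    exact (sub_eq_zero.1 h.symm).symm
  have h2 : mulFun U (n + 1) (polyFun f) (analytic_polyFun f) (d U n φ) =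
      (monomialDegree β b α + ∑ i, weight β b i - 1) • monomialForm U α := by
    -- In `d(fφ) = df ∧ φ + f dφ` the term `df ∧ φ = ω` accounts for the `-1`.
    have h := d_mulFun (analytic_polyFun f) φ
    rw [hφ, d_contract_monomialForm, ← dfWedge, h1] at h
    rw [sub_smul, h, one_smul, add_sub_cancel_left]
  have h3 : contract U n (eulerField β b) (d U n φ) =
      (monomialDegree β b α + ∑ i, weight β b i - 1) • φ := by
    apply inj
    rw [← contract_mulFun, h2, map_smul, map_smul, hφ]
  refine ⟨φ, h1, h2, ?_⟩
  -- For `n = 0` the Lie derivative has no `d i_K` term; otherwise that term vanishes because `i_K ∘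
  -- i_K = 0`.
  cases n with
  | zero => exact h3
  | succ n =>
    have h4 : contract U n (eulerField β b) φ = 0 := by
      apply inj
      rw [← contract_mulFun, hφ, contract_contract, map_zero]
    rw [lie, LinearMap.add_apply, LinearMap.comp_apply, LinearMap.comp_apply, h3, h4, map_zero,
      add_zero]

end Cohomology

end MilnorBundle

end

open MilnorBundle in
theorem lemma3p6 (n : ℕ) (f : MvPolynomial (Fin (n + 1)) ℂ) (β : Fin (n + 1) → ℕ) (b : ℕ)
    (hf : IsQuasihomogeneous f β b) (R δ : ℝ) (hR : 0 < R) (hδ : 0 < δ)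
    (V : TopologicalSpace.Opens ℂ) (hV : (V : Set ℂ) ⊆ Metric.ball 0 δ \ {0})
    (α : Fin (n + 1) → ℕ) :
    (∃! Φ : RelCohomology f (bundleOver f R V),
      dfWedgeClass f (bundleOver f R V) Φ = monomialClass f (bundleOver f R V) α) ∧
    ∀ Φ : RelCohomology f (bundleOver f R V),
      dfWedgeClass f (bundleOver f R V) Φ = monomialClass f (bundleOver f R V) α →
        lieClass hf (bundleOver f R V) Φ =
          (monomialDegree β b α + ∑ i, weight β b i - 1) • Φ ∧
        ∀ Ψ : RelCohomology f (bundleOver f R V),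
          IsGaussManinDeriv f (bundleOver f R V) Φ Ψ ↔
            Ψ = (monomialDegree β b α + ∑ i, weight β b i - 1) • Φ := by

  have h0 := polyFun_ne_zero_of_mem_bundleOver (f := f) (R := R) fun h => (hV h).2 rfl
  obtain ⟨φ, h1, h2, h3⟩ := exists_monomial_primitive hf h0 α
  have hφ : dfWedgeClass f (bundleOver f R V) (Submodule.Quotient.mk φ) =
      monomialClass f (bundleOver f R V) α :=
    (Submodule.mapQ_apply ..).trans (congrArg _ h1)
  refine ⟨⟨_, hφ, fun Φ hΦ => dfWedgeClass_injective hf h0 (hΦ.trans hφ.symm)⟩, ?_⟩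
  intro Φ hΦ
  -- By injectivity the arbitrary solution is the class of the explicit `φ`.
  obtain rfl := dfWedgeClass_injective hf h0 (hΦ.trans hφ.symm)
  refine ⟨(Submodule.mapQ_apply ..).trans (congrArg _ h3), fun Ψ => ?_⟩
  have h : IsGaussManinDeriv f (bundleOver f R V) (Submodule.Quotient.mk φ)
      ((monomialDegree β b α + ∑ i, weight β b i - 1) • Submodule.Quotient.mk φ) :=
    ⟨φ, _, rfl, rfl, by rw [h2, map_smul, h1]⟩
  exact ⟨fun hΨ => hΨ.unique hf h0 h, fun hΨ => hΨ ▸ h⟩
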